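/- Let $(X,d)$ be a compact metric space and $T:X\to X$ a continuous map. Let $\mathcal M_T$ be the set of $T$-invariant Borel probability measures on $X$, and for $B\in C^0(X)$ put $\beta_B=\max_{\mu\in\mathcal M_T}\int B\,d\mu$. Assume that - $T$ is topologically transitive, and - $T$ is weakly expanding: $K\mapsto T^{-1}(K)$ is $1$-Lipschitz on the compact subsets of $X$ with respect to the Hausdorff distance. A continuous function $f$ on $X$ with values in $\mathbb R$ or $\mathbb R^n$ is called a Walters function if there is a non-decreasing $H:[0,\infty)\to[0,\infty]$, with $H(0)=0$ and $H$ continuous at $0$, such that for all $s\ge 0$, all $k\ge 1$ and all $x,y\in X$, $$\max_{0\le j<k}d(T^jx,T^jy)\le s\ \Longrightarrow\ \Big\|\sum_{j=0}^{k-1}f(T^jx)-\sum_{j=0}^{k-1}f(T^jy)\Big\|\le H(s).$$ Let $A\in C^0(X)$ and $\varphi=(\varphi_1,\dots,\varphi_n)\in C^0(X,\mathbb R^n)$ be Walters functions. For $\mu\in\mathcal M_T$ put $\varphi_*(\mu)=\big(\int\varphi_1\,d\mu,\dots,\int\varphi_n\,d\mu\big)$, and define $$\beta_{A,\varphi}(h)=\sup\Big\{\int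 A\,d\mu:\ \mu\in\mathcal M_T,\ \varphi_*(\mu)=h\Big\}\quad (h\in\varphi_*(\mathcal M_T)),$$ $$\alpha_{A,\varphi}(c)=\min_{h\in\varphi_*(\mathcal M_T)}\big[\langle c,h\rangle-\beta_{A,\varphi}(h)\big]\quad (c\in\mathbb R^n).$$ Let $c\in\mathbb R^n$ and $B=A-\langle c,\varphi\rangle$. Let $u\in C^0(X)$ be a calibrated sub-action for $B$, that is, $B+u-u\circ T\le\beta_B$ on $X$ and $u(y)=\max_{T(x)=y}\big(B(x)+u(x)-\beta_B\big)$ for every $y\in X$. Let $\{x_j\}_{j\ge 0}\subset X$ be an optimal trajectory for $u$, that is, for every $j\ge 0$, $$T(x_{j+1})=x_j\quad\text{and}\quad u(x_j)=B(x_{j+1})+u(x_{j+1})-\beta_B.$$ If $\alpha_{A,\varphi}:\mathbb R^n\to\mathbb R$ is differentiable at $c$, then $$\lim_{k\to\infty}\frac1k\sum_{j=0}^{k-1}\varphi(x_j)=D\alpha_{A,\varphi}(c),$$ where the differential $D\alpha_{A,\varphi}(c)$ is identified with the gradient vector in $\mathbb R^n$. -/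

import Mathlib

/-! The empirical measures of an optimal trajectory `x` accumulate only at maximizing measures of
the tilted potential `B`: along `x` both `f ∘ T - f` and `B - β_B` telescope with a bounded
primitive, so their averages vanish in the limit. Since `α(c) = -β_{A - ⟨c, φ⟩}` is an infimum of
affine functions of `c`, the rotation vector of a maximizing measure is a supergradient of `α` at
`c`, hence equals the gradient. Every cluster point thus has the same rotation vector, and
compactness of the space of probability measures gives the limit. -/

open MeasureTheory Filter Topology
open scoped NNReal ENNReal

namespace RelMax

/-- `T` is topologically transitive. -/
def IsTransitive {X : Type*} [TopologicalSpace X] (T : C(X, X)) : Prop :=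
  ∀ U V : Set X, IsOpen U → U.Nonempty → IsOpen V → V.Nonempty →
    ∃ m : ℕ, (U ∩ (⇑T)^[m] ⁻¹' V).Nonempty

/-- The map `K ↦ T⁻¹(K)` on the compact subsets of a compact metric space. -/
def preimageCompacts {X : Type*} [MetricSpace X] [CompactSpace X] (T : C(X, X))
    (K : TopologicalSpace.Compacts X) : TopologicalSpace.Compacts X :=
  ⟨T ⁻¹' (K : Set X), (K.isCompact.isClosed.preimage T.continuous).isCompact⟩

/-- Weak expansion: `T⁻¹` is 1-Lipschitz on the compact subsets for the Hausdorff distance. -/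
def IsWeaklyExpanding {X : Type*} [MetricSpace X] [CompactSpace X] (T : C(X, X)) : Prop :=
  LipschitzWith 1 (preimageCompacts T)

/-- `d_k(x, y) = max_{0 ≤ j < k} d(T^j x, T^j y)`. -/
noncomputable def dynDist {X : Type*} [MetricSpace X] (T : C(X, X)) (k : ℕ) (x y : X) : ℝ≥0 :=
  (Finset.range k).sup fun j => nndist ((⇑T)^[j] x) ((⇑T)^[j] y)

/-- Walters functions. For `E = ℝ` the norm is the absolute value; for `E = ℝⁿ` the condition is
equivalent to every coordinate function being a Walters function. -/
def IsWalters {X : Type*} [MetricSpace X] {E : Type*} [NormedAddCommGroup E]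
    (T : C(X, X)) (f : C(X, E)) : Prop :=
  ∃ H : ℝ≥0 → ℝ≥0∞, Monotone H ∧ H 0 = 0 ∧ ContinuousAt H 0 ∧
    ∀ (s : ℝ≥0) (k : ℕ), 0 < k → ∀ x y : X, dynDist T k x y ≤ s →
      ‖birkhoffSum T f k x - birkhoffSum T f k y‖ₑ ≤ H s

section Measures

variable {X : Type*} [MetricSpace X] [MeasurableSpace X]

/-- The set of `T`-invariant Borel probability measures. -/
def invariantMeasures (T : C(X, X)) : Set (ProbabilityMeasure X) :=
  {μ | MeasurePreserving T (μ : Measure X) (μ : Measure X)}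

/-- `β_A`, the maximal integral of `A` over the invariant probability measures. -/
noncomputable def maxIntegral (T : C(X, X)) (A : C(X, ℝ)) : ℝ :=
  sSup ((fun μ : ProbabilityMeasure X => ∫ x, A x ∂(μ : Measure X)) '' invariantMeasures T)

/-- The rotation vector `φ_*(μ) = (∫ φ₁ dμ, …, ∫ φₙ dμ)`. -/
noncomputable def rotationVector {n : ℕ} (φ : C(X, EuclideanSpace ℝ (Fin n)))
    (μ : ProbabilityMeasure X) : EuclideanSpace ℝ (Fin n) :=
  WithLp.toLp 2 fun i => ∫ x, φ x i ∂(μ : Measure X)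

/-- The rotation set, the image of the invariant probability measures under `φ_*`. -/
def rotationSet {n : ℕ} (T : C(X, X)) (φ : C(X, EuclideanSpace ℝ (Fin n))) :
    Set (EuclideanSpace ℝ (Fin n)) :=
  rotationVector φ '' invariantMeasures T

/-- The beta function; it is meaningful for `h` in the rotation set. -/
noncomputable def betaFun {n : ℕ} (T : C(X, X)) (A : C(X, ℝ))
    (φ : C(X, EuclideanSpace ℝ (Fin n))) (h : EuclideanSpace ℝ (Fin n)) : ℝ :=
  sSup ((fun μ : ProbabilityMeasure X => ∫ x, A x ∂(μ : Measure X)) ''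
    {μ | μ ∈ invariantMeasures T ∧ rotationVector φ μ = h})

/-- The alpha function, the concave Fenchel transform of the beta function. -/
noncomputable def alphaFun {n : ℕ} (T : C(X, X)) (A : C(X, ℝ))
    (φ : C(X, EuclideanSpace ℝ (Fin n))) (c : EuclideanSpace ℝ (Fin n)) : ℝ :=
  sInf ((fun h => inner ℝ c h - betaFun T A φ h) '' rotationSet T φ)

/-- The potential `A - ⟨c, φ⟩`. -/
noncomputable def tilted {n : ℕ} (A : C(X, ℝ)) (φ : C(X, EuclideanSpace ℝ (Fin n)))
    (c : EuclideanSpace ℝ (Fin n)) : C(X, ℝ) where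
  toFun x := A x - inner ℝ c (φ x)
  continuous_toFun := by fun_prop

/-- `u` is a sub-action for `A`. -/
def IsSubaction (T : C(X, X)) (A u : C(X, ℝ)) : Prop :=
  ∀ x, A x + u x - u (T x) ≤ maxIntegral T A

/-- `u` is a calibrated sub-action for `A`: a sub-action with
`u(y) = max_{T x = y} (A + u - β_A)(x)` for every `y`, the maximum being attained. -/
def IsCalibratedSubaction (T : C(X, X)) (A u : C(X, ℝ)) : Prop :=
  IsSubaction T A u ∧
    ∀ y, IsGreatest ((fun x => A x + u x - maxIntegral T A) '' {x | T x = y}) (u y)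

/-- `x₀, x₁, …` is an optimal trajectory for the potential `A` and the calibrated
sub-action `u`. -/
def IsOptimalTrajectory (T : C(X, X)) (A u : C(X, ℝ)) (x : ℕ → X) : Prop :=
  ∀ j, T (x (j + 1)) = x j ∧ u (x j) = A (x (j + 1)) + u (x (j + 1)) - maxIntegral T A

end Measures

end RelMax

namespace RelMax

theorem tendsto_comp_of_forall_mapClusterPt {ι M Y : Type*} [TopologicalSpace M] [CompactSpace M]
    [TopologicalSpace Y] {f : M → Y} (hf : Continuous f) {ν : ι → M} {F : Filter ι} {a : Y}
    (h : ∀ μ, MapClusterPt μ F ν → f μ = a) : Tendsto (f ∘ ν) F (𝓝 a) := by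
  refine (tendsto_iff_ultrafilter _ _ _).2 fun U hU => ?_
  obtain ⟨μ, -, hμ⟩ := isCompact_univ.ultrafilter_le_nhds (U.map ν) (by simp)
  rw [← h μ (mapClusterPt_iff_ultrafilter.2 ⟨U, hU, hμ⟩)]
  exact (hf.tendsto μ).comp hμ

theorem tendsto_inv_smul_sum_sub_succ {E : Type*} [NormedAddCommGroup E] [NormedSpace ℝ E]
    {w : ℕ → E} (hw : Bornology.IsBounded (Set.range w)) :
    Tendsto (fun k : ℕ => (k : ℝ)⁻¹ • ∑ j ∈ Finset.range k, (w j - w (j + 1))) atTop (𝓝 0) := by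
  obtain ⟨C, hC⟩ := hw.exists_norm_le
  have hbound (k : ℕ) : ‖w 0 - w k‖ ≤ C + C :=
    norm_sub_le_of_le (hC _ ⟨0, rfl⟩) (hC _ ⟨k, rfl⟩)
  simp only [Finset.sum_range_sub']
  exact (tendsto_inv_atTop_nhds_zero_nat (𝕜 := ℝ)).zero_smul_isBoundedUnder_le
    (isBoundedUnder_of ⟨C + C, hbound⟩)

theorem eq_gradient_of_eventually_le_add_inner {E : Type*} [NormedAddCommGroup E]
    [InnerProductSpace ℝ E] [CompleteSpace E] {f : E → ℝ} {c g : E}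
    (hf : DifferentiableAt ℝ f c) (hg : ∀ᶠ c' in 𝓝 c, f c' ≤ f c + inner ℝ g (c' - c)) :
    g = gradient f c := by
  have hderiv : HasFDerivAt (fun c' => f c' - inner ℝ g c') (fderiv ℝ f c - innerSL ℝ g) c :=
    hf.hasFDerivAt.sub (innerSL ℝ g).hasFDerivAt
  have hmax : IsLocalMax (fun c' => f c' - inner ℝ g c') c := by
    filter_upwards [hg] with c' hc'
    rw [inner_sub_right] at hc'
    linarith
  have hfderiv : fderiv ℝ f c = innerSL ℝ g := sub_eq_zero.1 (hmax.hasFDerivAt_eq_zero hderiv)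
  refine ext_inner_right ℝ fun v => ?_
  rw [inner_gradient_left, hfderiv, innerSL_apply_apply]

theorem measurePreserving_of_forall_integral_comp_eq {X Y : Type*} [MeasurableSpace X]
    [TopologicalSpace Y] [MeasurableSpace Y] [BorelSpace Y] [HasOuterApproxClosed Y]
    {μ : Measure X} [IsFiniteMeasure μ] {ν : Measure Y} [IsFiniteMeasure ν] {T : X → Y}
    (hT : Measurable T) (h : ∀ f : BoundedContinuousFunction Y ℝ, ∫ x, f (T x) ∂μ = ∫ y, f y ∂ν) :
    MeasurePreserving T μ ν := by
  refine ⟨hT, ext_of_forall_integral_eq_of_IsFiniteMeasure fun f => ?_⟩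
  rw [integral_map hT.aemeasurable f.continuous.aestronglyMeasurable, h]

section EmpiricalMeasure

variable {X : Type*} [MeasurableSpace X]

/-- The empirical measure of the points `x 0, …, x k` of a sequence. There are `k + 1` of them, so
that it is a probability measure for every `k`. -/
noncomputable def empiricalMeasure (x : ℕ → X) (k : ℕ) : ProbabilityMeasure X :=
  ⟨((k + 1 : ℕ) : ℝ≥0∞)⁻¹ • ∑ j ∈ Finset.range (k + 1), Measure.dirac (x j), ⟨by
    simpa using ENNReal.inv_mul_cancel (Nat.cast_ne_zero.2 k.succ_ne_zero)
      (ENNReal.natCast_ne_top (k + 1))⟩⟩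

theorem integral_empiricalMeasure [MeasurableSingletonClass X] {E : Type*} [NormedAddCommGroup E]
    [NormedSpace ℝ E] [CompleteSpace E] (f : X → E) (x : ℕ → X) (k : ℕ) :
    ∫ y, f y ∂(empiricalMeasure x k : Measure X) =
      ((k + 1 : ℕ) : ℝ)⁻¹ • ∑ j ∈ Finset.range (k + 1), f (x j) := by
  rw [empiricalMeasure, ProbabilityMeasure.coe_mk, integral_smul_measure,
    integral_finsetSum_measure fun j _ => integrable_dirac enorm_lt_top, ENNReal.toReal_inv,
    ENNReal.toReal_natCast]
  simp only [integral_dirac]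

theorem integral_eq_zero_of_mapClusterPt_empiricalMeasure [TopologicalSpace X]
    [OpensMeasurableSpace X] [MeasurableSingletonClass X] {x : ℕ → X} {μ : ProbabilityMeasure X}
    (hμ : MapClusterPt μ atTop (empiricalMeasure x)) (f : BoundedContinuousFunction X ℝ)
    {w : ℕ → ℝ} (hw : Bornology.IsBounded (Set.range w)) (hf : ∀ j, f (x j) = w j - w (j + 1)) :
    ∫ y, f y ∂(μ : Measure X) = 0 := by
  have hlim : Tendsto (fun k => ∫ y, f y ∂(empiricalMeasure x k : Measure X)) atTop (𝓝 0) := by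
    simp only [integral_empiricalMeasure, hf]
    exact (tendsto_add_atTop_iff_nat 1).2 (tendsto_inv_smul_sum_sub_succ hw)
  have hcont : Continuous fun ν : ProbabilityMeasure X => ∫ y, f y ∂(ν : Measure X) :=
    ProbabilityMeasure.continuous_integral_boundedContinuousFunction f
  exact eq_of_nhds_neBot ((hμ.continuousAt_comp hcont.continuousAt).clusterPt.mono hlim)

end EmpiricalMeasure

theorem mem_invariantMeasures_of_mapClusterPt_empiricalMeasure {X : Type*} [MetricSpace X]
    [MeasurableSpace X] [BorelSpace X] {T : C(X, X)} {x : ℕ → X} (hx : ∀ j, T (x (j + 1)) = x j)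
    {μ : ProbabilityMeasure X} (hμ : MapClusterPt μ atTop (empiricalMeasure x)) :
    μ ∈ invariantMeasures T := by
  refine measurePreserving_of_forall_integral_comp_eq T.continuous.measurable fun f => ?_
  have hbdd : Bornology.IsBounded (Set.range fun j => f (T (x j))) :=
    f.isBounded_range.subset (Set.range_subset_iff.2 fun j => ⟨_, rfl⟩)
  have hzero := integral_eq_zero_of_mapClusterPt_empiricalMeasure hμ (f.compContinuous T - f) hbdd
    fun j => by simp [hx j]
  exact sub_eq_zero.1 ((integral_sub ((f.compContinuous T).integrable _)
    (f.integrable _)).symm.trans hzero)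

section ContinuousMap

variable {X : Type*} [TopologicalSpace X] [CompactSpace X] [MeasurableSpace X]
  [OpensMeasurableSpace X]

theorem integrable_continuousMap {E : Type*} [NormedAddCommGroup E] (f : C(X, E))
    (μ : Measure X) [IsFiniteMeasureOnCompacts μ] : Integrable f μ :=
  f.continuous.integrable_of_hasCompactSupport (HasCompactSupport.of_compactSpace f)

theorem bddAbove_integral_image (f : C(X, ℝ)) (s : Set (ProbabilityMeasure X)) :
    BddAbove ((fun μ : ProbabilityMeasure X => ∫ y, f y ∂(μ : Measure X)) '' s) := by
  refine ⟨‖f‖, Set.forall_mem_image.2 fun μ _ => ?_⟩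
  exact (le_abs_self _).trans
    ((BoundedContinuousFunction.mkOfCompact f).norm_integral_le_norm (μ : Measure X))

end ContinuousMap

/-- `μ` is a maximizing measure for the potential `B`: an invariant probability measure at which
the supremum `β_B` is attained. -/
def IsMaximizing {X : Type*} [MetricSpace X] [MeasurableSpace X] (T : C(X, X)) (B : C(X, ℝ))
    (μ : ProbabilityMeasure X) : Prop :=
  μ ∈ invariantMeasures T ∧ ∫ y, B y ∂(μ : Measure X) = maxIntegral T B

theorem IsOptimalTrajectory.isMaximizing_of_mapClusterPt {X : Type*} [MetricSpace X]
    [CompactSpace X] [MeasurableSpace X] [BorelSpace X] {T : C(X, X)} {B u : C(X, ℝ)} {x : ℕ → X}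
    (hx : IsOptimalTrajectory T B u x) {μ : ProbabilityMeasure X}
    (hμ : MapClusterPt μ atTop (empiricalMeasure x)) : IsMaximizing T B μ := by
  refine ⟨mem_invariantMeasures_of_mapClusterPt_empiricalMeasure (fun j => (hx j).1) hμ, ?_⟩
  have hbdd : Bornology.IsBounded (Set.range fun j => (B + u) (x j)) :=
    (isCompact_range (B + u).continuous).isBounded.subset
      (Set.range_subset_iff.2 fun j => ⟨_, rfl⟩)
  have hzero := integral_eq_zero_of_mapClusterPt_empiricalMeasure hμ
    (BoundedContinuousFunction.mkOfCompact (B - ContinuousMap.const X (maxIntegral T B))) hbdd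
    fun j => by
      simp only [BoundedContinuousFunction.mkOfCompact_apply, ContinuousMap.sub_apply,
        ContinuousMap.const_apply, ContinuousMap.add_apply, (hx j).2]
      ring
  have hsub : ∫ y, (B y - maxIntegral T B) ∂(μ : Measure X) = 0 := hzero
  rw [integral_sub (integrable_continuousMap B _) (integrable_const _), integral_const] at hsub
  simpa [sub_eq_zero] using hsub

section Alpha

variable {X : Type*} [MetricSpace X] [CompactSpace X] [MeasurableSpace X]
  [OpensMeasurableSpace X] {T : C(X, X)}

theorem integral_le_maxIntegral (B : C(X, ℝ)) {μ : ProbabilityMeasure X}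
    (hμ : μ ∈ invariantMeasures T) : ∫ y, B y ∂(μ : Measure X) ≤ maxIntegral T B :=
  le_csSup (bddAbove_integral_image B _) (Set.mem_image_of_mem _ hμ)

variable {n : ℕ} (A : C(X, ℝ)) (φ : C(X, EuclideanSpace ℝ (Fin n)))
  (c : EuclideanSpace ℝ (Fin n))

theorem rotationVector_eq_integral (μ : ProbabilityMeasure X) :
    rotationVector φ μ = ∫ y, φ y ∂(μ : Measure X) := by
  ext i
  exact (eval_integral_piLp (fun i => (integrable_continuousMap φ _).eval_piLp i) i).symm

theorem continuous_rotationVector : Continuous (rotationVector φ) :=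
  (PiLp.continuous_toLp 2 _).comp <| continuous_pi fun i =>
    ProbabilityMeasure.continuous_integral_boundedContinuousFunction
      (BoundedContinuousFunction.mkOfCompact ⟨fun y => φ y i, by fun_prop⟩)

theorem integral_tilted (μ : ProbabilityMeasure X) :
    ∫ y, tilted A φ c y ∂(μ : Measure X) =
      ∫ y, A y ∂(μ : Measure X) - inner ℝ c (rotationVector φ μ) := by
  have hφ : Integrable φ (μ : Measure X) := integrable_continuousMap φ _
  rw [rotationVector_eq_integral, ← integral_inner hφ c]
  exact integral_sub (integrable_continuousMap A _) (hφ.const_inner c)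

theorem integral_le_betaFun {μ : ProbabilityMeasure X} (hμ : μ ∈ invariantMeasures T) :
    ∫ y, A y ∂(μ : Measure X) ≤ betaFun T A φ (rotationVector φ μ) :=
  le_csSup (bddAbove_integral_image A _) (Set.mem_image_of_mem _ ⟨hμ, rfl⟩)

variable {φ} in
theorem betaFun_le_maxIntegral_tilted_add_inner {h : EuclideanSpace ℝ (Fin n)}
    (hh : h ∈ rotationSet T φ) :
    betaFun T A φ h ≤ maxIntegral T (tilted A φ c) + inner ℝ c h := by
  obtain ⟨μ, hμ, hμh⟩ := hh
  refine csSup_le ⟨_, Set.mem_image_of_mem _ ⟨hμ, hμh⟩⟩ (Set.forall_mem_image.2 ?_)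
  rintro ν ⟨hν, rfl⟩
  rw [← sub_le_iff_le_add, ← integral_tilted]
  exact integral_le_maxIntegral _ hν

theorem alphaFun_eq_neg_maxIntegral_tilted (hne : (invariantMeasures T).Nonempty) :
    alphaFun T A φ c = -maxIntegral T (tilted A φ c) := by
  have hlower : ∀ a ∈ (fun h => inner ℝ c h - betaFun T A φ h) '' rotationSet T φ,
      -maxIntegral T (tilted A φ c) ≤ a :=
    Set.forall_mem_image.2 fun h hh => by
      linarith [betaFun_le_maxIntegral_tilted_add_inner A c hh]
  refine le_antisymm ?_ (le_csInf ((hne.image _).image _) hlower)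
  refine le_neg_of_le_neg (csSup_le (hne.image _) (Set.forall_mem_image.2 fun μ hμ => ?_))
  have halpha : alphaFun T A φ c ≤
      inner ℝ c (rotationVector φ μ) - betaFun T A φ (rotationVector φ μ) :=
    csInf_le ⟨_, hlower⟩ (Set.mem_image_of_mem _ (Set.mem_image_of_mem _ hμ))
  rw [integral_tilted]
  linarith [integral_le_betaFun A φ hμ]

variable {A φ c} in
theorem IsMaximizing.alphaFun_le_add_inner {μ : ProbabilityMeasure X}
    (hμ : IsMaximizing T (tilted A φ c) μ) (c' : EuclideanSpace ℝ (Fin n)) :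
    alphaFun T A φ c' ≤ alphaFun T A φ c + inner ℝ (rotationVector φ μ) (c' - c) := by
  obtain ⟨hinv, hmax⟩ := hμ
  calc alphaFun T A φ c' = -maxIntegral T (tilted A φ c') :=
        alphaFun_eq_neg_maxIntegral_tilted A φ c' ⟨μ, hinv⟩
    _ ≤ -∫ y, tilted A φ c' y ∂(μ : Measure X) := neg_le_neg (integral_le_maxIntegral _ hinv)
    _ = -∫ y, tilted A φ c y ∂(μ : Measure X) + inner ℝ (rotationVector φ μ) (c' - c) := by
        rw [integral_tilted, integral_tilted, inner_sub_right, real_inner_comm c',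
          real_inner_comm c]
        ring
    _ = alphaFun T A φ c + inner ℝ (rotationVector φ μ) (c' - c) := by
        rw [hmax, alphaFun_eq_neg_maxIntegral_tilted A φ c ⟨μ, hinv⟩]

end Alpha

end RelMax

theorem theorem17_general {X : Type*} [MetricSpace X] [CompactSpace X] [MeasurableSpace X]
    [BorelSpace X] {T : C(X, X)} {n : ℕ} {A : C(X, ℝ)} {φ : C(X, EuclideanSpace ℝ (Fin n))}
    {c : EuclideanSpace ℝ (Fin n)} {u : C(X, ℝ)} {x : ℕ → X}
    (hx : RelMax.IsOptimalTrajectory T (RelMax.tilted A φ c) u x)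
    (hα : DifferentiableAt ℝ (RelMax.alphaFun T A φ) c) :
    Tendsto (fun k : ℕ => (k : ℝ)⁻¹ • ∑ j ∈ Finset.range k, φ (x j)) atTop
      (𝓝 (gradient (RelMax.alphaFun T A φ) c)) := by
  have hlim : Tendsto (RelMax.rotationVector φ ∘ RelMax.empiricalMeasure x) atTop
      (𝓝 (gradient (RelMax.alphaFun T A φ) c)) := by
    refine RelMax.tendsto_comp_of_forall_mapClusterPt (RelMax.continuous_rotationVector φ)
      fun μ hμ => ?_
    have hmax : RelMax.IsMaximizing T (RelMax.tilted A φ c) μ := hx.isMaximizing_of_mapClusterPt hμ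
    exact RelMax.eq_gradient_of_eventually_le_add_inner hα (.of_forall hmax.alphaFun_le_add_inner)
  refine (tendsto_add_atTop_iff_nat 1).1 (hlim.congr fun k => ?_)
  rw [Function.comp_apply, RelMax.rotationVector_eq_integral, RelMax.integral_empiricalMeasure]

theorem theorem17 {X : Type*} [MetricSpace X] [CompactSpace X] [MeasurableSpace X] [BorelSpace X]
    (T : C(X, X)) (hT : RelMax.IsTransitive T) (hexp : RelMax.IsWeaklyExpanding T)
    {n : ℕ} (A : C(X, ℝ)) (hA : RelMax.IsWalters T A)
    (φ : C(X, EuclideanSpace ℝ (Fin n))) (hφ : RelMax.IsWalters T φ)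
    (c : EuclideanSpace ℝ (Fin n))
    (u : C(X, ℝ)) (hu : RelMax.IsCalibratedSubaction T (RelMax.tilted A φ c) u)
    (x : ℕ → X) (hx : RelMax.IsOptimalTrajectory T (RelMax.tilted A φ c) u x)
    (hα : DifferentiableAt ℝ (RelMax.alphaFun T A φ) c) :
    Tendsto (fun k : ℕ => (k : ℝ)⁻¹ • ∑ j ∈ Finset.range k, φ (x j)) atTop
      (𝓝 (gradient (RelMax.alphaFun T A φ) c)) :=
  theorem17_general hx hα
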